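/- **Hashing with coalesced chains.** Let $0<n\le m$ be integers. Items $x_1,\dots,x_n$ with hash addresses $h_1,\dots,h_n\in\{1,\dots,m\}$ are inserted one after another into a table of $m$ cells, initially empty, each with a link field that is initially null. If cell $h_i$ is empty, $x_i$ is put there. Otherwise $x_i$ is put into the empty cell $j$ of largest index, and $j$ is linked into the chain through $h_i$: at the end of the chain under late insertion ($\mathsf L$), or immediately after $h_i$ under early insertion ($\mathsf E$; the link of $j$ is set to the old link of $h_i$, and the link of $h_i$ to $j$). Let $\mathcal T_{m,n}$ be the random table obtained when all $m^n$ hash sequences are equally likely. For $\Xi\in\{\mathsf L,\mathsf E\}$ let $d^\Xi(\mathcal T_{m,n})$ be the final displacement of an item $x_I$, where $I$ is uniform on $\{1,\dots,n\}$ and independent of the table; the displacement of $x_i$ is the number of links followed from $h_i$ until $x_i$ is found. Let $d^{\mathsf U}(\mathcal T_{m,n})$ be the number of occupied cells encountered in an unsuccessful search (following links until a null link) started at a cell $J$ that is uniform on $\{1,\dots,m\}$ and independent of the table. For $\alpha\in[0,1]$ define $$p^{\mathsf U}_\alpha(0)=1-\alpha,\qquad p^{\mathsf U}_\alpha(k)=\int_0^\alpha(1-\alpha+t)(1-e^{-t})^{k-1}\,dt\quad(k\ge1),$$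 $$p^{\mathsf L}_\alpha(0)=1-\tfrac{\alpha}{2},\qquad p^{\mathsf L}_\alpha(k)=\frac1\alpha\int_0^\alpha\Bigl(\alpha-t-\tfrac{(\alpha-t)^2}2\Bigr)(1-e^{-t})^{k-1}\,dt\quad(k\ge1),$$ $$p^{\mathsf E}_\alpha(0)=1-\tfrac{\alpha}{2},\qquad p^{\mathsf E}_\alpha(k)=\frac1\alpha\int_0^\alpha(\alpha-t)e^{-t}(1-e^{-t})^{k-1}\,dt\quad(k\ge1),$$ where $p^{\mathsf L}_0(k)=p^{\mathsf E}_0(k)=0$ for $k\ge1$. Each of these is a probability distribution on $\{0,1,2,\dots\}$; let $D^{\mathsf U}_\alpha,D^{\mathsf L}_\alpha,D^{\mathsf E}_\alpha$ be random variables with these distributions. **Corollary.** Suppose that $m,n\to\infty$ with $0<n\le m$ and $n/m\to\alpha\in[0,1]$. Then (with $d^{\mathsf U}$ taken in the table built by either insertion policy) $$\mathbb E\,d^{\mathsf U}(\mathcal T_{m,n})\to\mathbb E D^{\mathsf U}_\alpha=\tfrac14\bigl(e^{2\alpha}-1\bigr)+\tfrac{\alpha}{2},$$ $$\mathbb E\,d^{\mathsf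 L}(\mathcal T_{m,n})\to\mathbb E D^{\mathsf L}_\alpha=\tfrac1{8\alpha}\bigl(e^{2\alpha}-1\bigr)+\tfrac{\alpha}{4}-\tfrac14,$$ $$\mathbb E\,d^{\mathsf E}(\mathcal T_{m,n})\to\mathbb E D^{\mathsf E}_\alpha=\tfrac1\alpha\bigl(e^{\alpha}-1-\alpha\bigr),$$ where for $\alpha=0$ the last two right-hand sides are read as their limits as $\alpha\downarrow0$, namely $0$. -/

import Mathlib

namespace CoalescedHashing

/-- The two insertion policies: late insertion (new item at the end of its chain) and
early insertion (new item linked in immediately after its hash address). -/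
inductive Policy where
  | late
  | early

/-- A table with `m` cells: the item stored in each cell (`none` for an empty cell; items are
numbered `0, 1, 2, …` in order of arrival) and the link field of each cell (`none` for a null
link). -/
structure Table (m : ℕ) where
  content : Fin m → Option ℕ
  link : Fin m → Option (Fin m)

namespace Table

variable {m : ℕ}

/-- The table in which all cells are empty and all links are null. -/
def empty (m : ℕ) : Table m where
  content := fun _ => none
  link := fun _ => none

/-- The cells met when starting at cell `c` and following links until a null link, cut off after
`k` cells. -/
def walk (T : Table m) : ℕ → Fin m → List (Fin m)
  | 0, _ => []
  | k + 1, c =>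
    c :: (match T.link c with
      | none => []
      | some c' => T.walk k c')

/-- All the cells met when starting at `c` and following links until a null link. The cut-off at
`m` is harmless: in a table with `m` cells a chain has at most `m` cells. -/
def search (T : Table m) (c : Fin m) : List (Fin m) := T.walk m c

/-- The last cell of the chain through `c`. -/
def chainEnd (T : Table m) (c : Fin m) : Fin m := (T.search c).getLastD c

/-- The set of empty cells. -/
def emptyCells (T : Table m) : Finset (Fin m) :=
  Finset.univ.filter fun c => T.content c = none

/-- Insertion of item `x` with hash address `a` under a given policy. If cell `a` is empty, the
item is put there. Otherwise it is put in the empty cell `j` of largest index, and `j` is linked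
in at the end of the chain (late insertion) or immediately after `a` (early insertion). An
insertion into a full table is ignored. -/
def insert (Ξ : Policy) (T : Table m) (x : ℕ) (a : Fin m) : Table m :=
  if T.content a = none then
    { T with content := Function.update T.content a (some x) }
  else if hT : T.emptyCells.Nonempty then
    let j := T.emptyCells.max' hT
    { content := Function.update T.content j (some x)
      link :=
        match Ξ with
        | .late => Function.update T.link (T.chainEnd a) (some j)
        | .early => Function.update (Function.update T.link j (T.link a)) a (some j) }
  else T

end Table

/-- The table built by inserting items `0, …, n - 1` successively, item `i` having hash
address `h i`. -/
def build (Ξ : Policy) {m : ℕ} : (n : ℕ) → (Fin n → Fin m) → Table m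
  | 0, _ => Table.empty m
  | n + 1, h => (build Ξ n fun i => h i.castSucc).insert Ξ n (h (Fin.last n))

/-- The final displacement of item `i`: the number of links that are followed from its hash
address until the item is found. -/
def displacement (Ξ : Policy) {m n : ℕ} (h : Fin n → Fin m) (i : Fin n) : ℕ :=
  ((build Ξ n h).search (h i)).findIdx fun c => (build Ξ n h).content c == some (i : ℕ)

/-- The number of occupied cells encountered in an unsuccessful search that starts at cell `j`. -/
def unsuccessful (Ξ : Policy) {m n : ℕ} (h : Fin n → Fin m) (j : Fin m) : ℕ :=
  ((build Ξ n h).search j).countP fun c => (build Ξ n h).content c != none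

open MeasureTheory ProbabilityTheory

noncomputable section

/-- The law of the random hash table with `m` cells and `n` items: all `m ^ n` hash sequences are
equally likely. -/
def tableLaw (m n : ℕ) : Measure (Fin n → Fin m) := uniformOn Set.univ

/-- The expected displacement of a uniformly random item in the random hash table. -/
def meanDisplacement (Ξ : Policy) (m n : ℕ) : ℝ :=
  ∫ ω : (Fin n → Fin m) × Fin n, (displacement Ξ ω.1 ω.2 : ℝ)
    ∂((tableLaw m n).prod (uniformOn Set.univ))

/-- The expected number of occupied cells encountered in an unsuccessful search from a uniformly
random cell of the random hash table (built with policy `Ξ`). -/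
def meanUnsuccessful (Ξ : Policy) (m n : ℕ) : ℝ :=
  ∫ ω : (Fin n → Fin m) × Fin m, (unsuccessful Ξ ω.1 ω.2 : ℝ)
    ∂((tableLaw m n).prod (uniformOn Set.univ))

/-- The limiting probabilities for unsuccessful searches. -/
def pU (α : ℝ) : ℕ → ℝ
  | 0 => 1 - α
  | k + 1 => ∫ t in (0 : ℝ)..α, (1 - α + t) * (1 - Real.exp (-t)) ^ k

/-- The limiting probabilities for late insertion; for `α = 0` this is the point mass at `0`. -/
def pL (α : ℝ) : ℕ → ℝ
  | 0 => 1 - α / 2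
  | k + 1 => α⁻¹ * ∫ t in (0 : ℝ)..α, (α - t - (α - t) ^ 2 / 2) * (1 - Real.exp (-t)) ^ k

/-- The limiting probabilities for early insertion; for `α = 0` this is the point mass at `0`. -/
def pE (α : ℝ) : ℕ → ℝ
  | 0 => 1 - α / 2
  | k + 1 => α⁻¹ * ∫ t in (0 : ℝ)..α, (α - t) * Real.exp (-t) * (1 - Real.exp (-t)) ^ k

/-- The sequence `p` is a probability distribution on `ℕ`. -/
def IsDistribution (p : ℕ → ℝ) : Prop := (∀ k, 0 ≤ p k) ∧ HasSum p 1

/-- The measure on `ℕ` with point masses `p k`. -/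
def law (p : ℕ → ℝ) : Measure ℕ :=
  Measure.sum fun k => ENNReal.ofReal (p k) • Measure.dirac k

/-- The sequence `p` is a probability distribution on `ℕ`, and a random variable with this
distribution has finite mean equal to `μ`. -/
def HasMean (p : ℕ → ℝ) (μ : ℝ) : Prop :=
  IsDistribution p ∧ Integrable (fun k : ℕ => (k : ℝ)) (law p) ∧ ∫ k : ℕ, (k : ℝ) ∂(law p) = μ

end

end CoalescedHashing

/-! All three means have exact closed forms for finite `m` and `n`; the corollary is then elementary
analysis. The key quantity is the weight W of a table, the total search length over its occupied
cells. An empty start cell contributes no occupied cell to an unsuccessful search, so the mean cost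
over a uniform start is W/m (`sum_countP_search`).

Insert one more item and sum over its `m` possible addresses. Under both policies the new weights
total (m + 2)W + (m - n), although for different reasons. With late insertion, an occupied address
lengthens every search in its chain; counting pairs of cells in a common chain gives 2W - n, because
2W = n + `pairs` is invariant. With early insertion, an occupied address lengthens exactly the
searches that pass through it, and double counting gives W; the searches from the new cells give
another W. Hence `weightSum_succ`, solved in `four_mul_weightSum`.

Displacements follow similar recurrences. Late insertion never moves an old item, and the
displacements of the new item total W (`dispSum_late_succ`). Early insertion pushes an old item at
displacement d one step further for d of the addresses, and the new item is at displacement 0 or 1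
(`dispSum_early_succ`). The solutions involve only (1 + 2/m)^n and (1 + 1/m)^n, whose limits are
e^(2α) and e^α.

On the limit side, the three laws are, away from 0, mixtures of geometric weights with ratio 1 -
e^(-t). Summation under the integral turns the total mass and the mean into integrals against e^t
and e^(2t) (`hasMean_of_mixture`), which have explicit primitives. -/

namespace CoalescedHashing

/-! ### Chains of links and the structural invariants of a table. -/

namespace Table

variable {m : ℕ}

/-- `T.ChainFrom c l` says that following links from `c` until a null link meets exactly the
cells of `l`, in this order. -/
inductive ChainFrom (T : Table m) : Fin m → List (Fin m) → Prop
  | last {c : Fin m} (hc : T.link c = none) : ChainFrom T c [c]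
  | cons {c c' : Fin m} {l : List (Fin m)} (hc : T.link c = some c') (hl : ChainFrom T c' l) :
      ChainFrom T c (c :: l)

namespace ChainFrom

variable {T T' : Table m} {c : Fin m} {l l' : List (Fin m)}

theorem ne_nil (h : T.ChainFrom c l) : l ≠ [] := by
  cases h <;> simp

theorem unique (h : T.ChainFrom c l) (h' : T.ChainFrom c l') : l = l' := by
  induction h generalizing l' with
  | last hc =>
    cases h' with
    | last => rfl
    | cons hc' => simp [hc] at hc'
  | cons hc hl ih =>
    cases h' with
    | last hc' => simp [hc] at hc'
    | cons hc' hl' =>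
      obtain rfl : _ = _ := Option.some.inj (hc.symm.trans hc')
      rw [ih hl']

theorem exists_of_mem (h : T.ChainFrom c l) {a : Fin m} (ha : a ∈ l) :
    ∃ l₂, T.ChainFrom a l₂ ∧ l₂.length ≤ l.length := by
  induction h with
  | last hc =>
    obtain rfl := List.mem_singleton.1 ha
    exact ⟨_, .last hc, le_rfl⟩
  | @cons c c' l hc hl ih =>
    rcases List.mem_cons.1 ha with rfl | ha
    · exact ⟨_, .cons hc hl, le_rfl⟩
    · obtain ⟨l₂, h₂, hle⟩ := ih ha
      exact ⟨l₂, h₂, hle.trans (by simp)⟩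

/-- Links are deterministic, so a cell that recurred in its own tail would have the whole chain as a
chain no longer than that tail. This bounds chain lengths by `m`, which justifies the cut-off in
`search`. -/
theorem nodup (h : T.ChainFrom c l) : l.Nodup := by
  induction h with
  | last hc => simp
  | @cons c c' l hc hl ih =>
    refine List.nodup_cons.2 ⟨fun hmem => ?_, ih⟩
    obtain ⟨l₂, h₂, hle⟩ := hl.exists_of_mem hmem
    obtain rfl := h₂.unique (.cons hc hl)
    simp at hle

theorem length_le (h : T.ChainFrom c l) : l.length ≤ m := by
  simpa using h.nodup.length_le_card

theorem walk_eq (h : T.ChainFrom c l) {k : ℕ} (hk : l.length ≤ k) : T.walk k c = l := by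
  induction h generalizing k with
  | last hc =>
    obtain ⟨k, rfl⟩ : ∃ k', k = k' + 1 := ⟨k - 1, by simp at hk; omega⟩
    simp [walk, hc]
  | cons hc hl ih =>
    obtain ⟨k, rfl⟩ : ∃ k', k = k' + 1 := ⟨k - 1, by simp at hk; omega⟩
    simp only [List.length_cons, Nat.add_le_add_iff_right] at hk
    simp [walk, hc, ih hk]

theorem search_eq (h : T.ChainFrom c l) : T.search c = l := h.walk_eq h.length_le

theorem congr_link (h : T.ChainFrom c l) (hl : ∀ x ∈ l, T'.link x = T.link x) :
    T'.ChainFrom c l := by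
  induction h with
  | last hc => exact .last (by rw [hl _ (by simp), hc])
  | cons hc _ ih =>
    exact .cons (by rw [hl _ (by simp), hc]) (ih fun x hx => hl x (by simp [hx]))

theorem link_getLastD (h : T.ChainFrom c l) (d : Fin m) : T.link (l.getLastD d) = none := by
  induction h generalizing d with
  | last hc => simpa using hc
  | cons hc hl ih =>
    rw [List.getLastD_cons]
    exact ih _

theorem getLastD_eq (h : T.ChainFrom c l) (d d' : Fin m) : l.getLastD d = l.getLastD d' := by
  cases h <;> simp only [List.getLastD_cons]

theorem getLastD_mem (h : T.ChainFrom c l) (d : Fin m) : l.getLastD d ∈ l := by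
  rw [List.getLastD_eq_getLast?, List.getLast?_eq_getLast_of_ne_nil h.ne_nil]
  exact List.getLast_mem _

end ChainFrom

/-- The set of occupied cells. -/
def occupied (T : Table m) : Finset (Fin m) := T.emptyCellsᶜ

theorem mem_occupied {T : Table m} {c : Fin m} : c ∈ T.occupied ↔ T.content c ≠ none := by
  simp [occupied, emptyCells]

theorem mem_emptyCells {T : Table m} {c : Fin m} : c ∈ T.emptyCells ↔ T.content c = none := by
  simp [emptyCells]

/-- The structural properties of a table that holds the items `0, …, n - 1`. -/
structure IsTable (T : Table m) (n : ℕ) : Prop where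
  chain : ∀ c, ∃ l, T.ChainFrom c l
  link_of_empty : ∀ c, T.content c = none → T.link c = none
  content_of_link : ∀ c c', T.link c = some c' → T.content c' ≠ none
  content_lt : ∀ c k, T.content c = some k → k < n
  card_occupied : T.occupied.card = n

namespace IsTable

variable {T : Table m} {n : ℕ}

theorem chainFrom_search (hT : T.IsTable n) (c : Fin m) : T.ChainFrom c (T.search c) := by
  obtain ⟨l, hl⟩ := hT.chain c
  rwa [hl.search_eq]

theorem search_of_empty (hT : T.IsTable n) {c : Fin m} (hc : T.content c = none) :
    T.search c = [c] :=
  (ChainFrom.last (hT.link_of_empty c hc)).search_eq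

theorem content_of_mem_chain (hT : T.IsTable n) {c x : Fin m} {l : List (Fin m)}
    (h : T.ChainFrom c l) (hc : T.content c ≠ none) (hx : x ∈ l) : T.content x ≠ none := by
  induction h with
  | last => rwa [List.mem_singleton.1 hx]
  | cons hl _ ih =>
    rcases List.mem_cons.1 hx with rfl | hx
    · exact hc
    · exact ih (hT.content_of_link _ _ hl) hx

theorem content_of_mem_search (hT : T.IsTable n) {c x : Fin m} (hc : T.content c ≠ none)
    (hx : x ∈ T.search c) : T.content x ≠ none :=
  hT.content_of_mem_chain (hT.chainFrom_search c) hc hx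

theorem chainEnd_mem (hT : T.IsTable n) (c : Fin m) : T.chainEnd c ∈ T.search c :=
  (hT.chainFrom_search c).getLastD_mem c

theorem content_chainEnd (hT : T.IsTable n) {c : Fin m} (hc : T.content c ≠ none) :
    T.content (T.chainEnd c) ≠ none :=
  hT.content_of_mem_search hc (hT.chainEnd_mem c)

theorem chainEnd_of_empty (hT : T.IsTable n) {c : Fin m} (hc : T.content c = none) :
    T.chainEnd c = c := by
  simp [chainEnd, hT.search_of_empty hc]

theorem card_emptyCells (hT : T.IsTable n) : T.emptyCells.card = m - n := by
  have := Finset.card_compl_add_card T.emptyCells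
  have h := hT.card_occupied
  rw [occupied] at h
  simp only [Fintype.card_fin] at this
  omega

theorem emptyCells_nonempty (hT : T.IsTable n) (hn : n < m) : T.emptyCells.Nonempty := by
  rw [← Finset.card_pos, hT.card_emptyCells]
  omega

end IsTable

theorem isTable_empty : (Table.empty m).IsTable 0 where
  chain c := ⟨[c], .last rfl⟩
  link_of_empty _ _ := rfl
  content_of_link _ _ h := by simp [Table.empty] at h
  content_lt _ _ h := by simp [Table.empty] at h
  card_occupied := by simp [occupied, emptyCells, Table.empty]

theorem occupied_update {T T' : Table m} {j : Fin m} {n : ℕ}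
    (h : T'.content = Function.update T.content j (some n)) :
    T'.occupied = Insert.insert j T.occupied := by
  ext c
  rw [Finset.mem_insert, mem_occupied, mem_occupied, h]
  by_cases hc : c = j <;> simp [hc]

theorem not_mem_occupied {T : Table m} {c : Fin m} (hc : T.content c = none) :
    c ∉ T.occupied := by
  simp [mem_occupied, hc]

/-- The table obtained by putting item `x` in cell `a`. -/
def put (T : Table m) (x : ℕ) (a : Fin m) : Table m :=
  { T with content := Function.update T.content a (some x) }

/-- The table obtained by putting item `x` in cell `j` and linking `j` at the end of the chain
through `a`. -/
def linkLate (T : Table m) (x : ℕ) (a j : Fin m) : Table m where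
  content := Function.update T.content j (some x)
  link := Function.update T.link (T.chainEnd a) (some j)

/-- The table obtained by putting item `x` in cell `j` and linking `j` immediately after `a`. -/
def linkEarly (T : Table m) (x : ℕ) (a j : Fin m) : Table m where
  content := Function.update T.content j (some x)
  link := Function.update (Function.update T.link j (T.link a)) a (some j)

theorem insert_of_empty (Ξ : Policy) {T : Table m} (x : ℕ) {a : Fin m} (ha : T.content a = none) :
    T.insert Ξ x a = T.put x a := by
  simp [insert, ha, put]

/-- Of the rule choosing the cell `j`, only its emptiness is retained: the largest-index rule plays
no role in the means. -/
theorem insert_late {T : Table m} (x : ℕ) {a : Fin m} (ha : T.content a ≠ none)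
    (hT : T.emptyCells.Nonempty) :
    ∃ j, T.content j = none ∧ T.insert .late x a = T.linkLate x a j :=
  ⟨T.emptyCells.max' hT, mem_emptyCells.1 (Finset.max'_mem _ hT), by
    simp [insert, ha, hT, linkLate]⟩

theorem insert_early {T : Table m} (x : ℕ) {a : Fin m} (ha : T.content a ≠ none)
    (hT : T.emptyCells.Nonempty) :
    ∃ j, T.content j = none ∧ T.insert .early x a = T.linkEarly x a j :=
  ⟨T.emptyCells.max' hT, mem_emptyCells.1 (Finset.max'_mem _ hT), by
    simp [insert, ha, hT, linkEarly]⟩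

theorem walk_put (T : Table m) (x : ℕ) (a : Fin m) (k : ℕ) (c : Fin m) :
    (T.put x a).walk k c = T.walk k c := by
  induction k generalizing c with
  | zero => rfl
  | succ k ih => simp only [walk, ih]; rfl

theorem search_put (T : Table m) (x : ℕ) (a c : Fin m) : (T.put x a).search c = T.search c :=
  walk_put T x a m c

theorem chainEnd_put (T : Table m) (x : ℕ) (a c : Fin m) :
    (T.put x a).chainEnd c = T.chainEnd c := by
  simp [chainEnd, search_put]

/-- Insertion of `j` after every occurrence of `a` in a list. -/
def insertAfter (a j : Fin m) (l : List (Fin m)) : List (Fin m) :=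
  l.flatMap fun x => if x = a then [a, j] else [x]

theorem insertAfter_cons_self (a j : Fin m) (l : List (Fin m)) :
    insertAfter a j (a :: l) = a :: j :: insertAfter a j l := by
  simp [insertAfter]

theorem insertAfter_cons_of_ne {a x : Fin m} (hx : x ≠ a) (j : Fin m) (l : List (Fin m)) :
    insertAfter a j (x :: l) = x :: insertAfter a j l := by
  simp [insertAfter, hx]

theorem insertAfter_of_not_mem {a : Fin m} (j : Fin m) {l : List (Fin m)} (ha : a ∉ l) :
    insertAfter a j l = l := by
  induction l with
  | nil => rfl
  | cons x l ih =>
    simp only [List.mem_cons, not_or] at ha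
    rw [insertAfter_cons_of_ne (Ne.symm ha.1), ih ha.2]

theorem length_insertAfter (a j : Fin m) (l : List (Fin m)) :
    (insertAfter a j l).length = l.length + l.count a := by
  induction l with
  | nil => rfl
  | cons x l ih =>
    by_cases hx : x = a
    · subst hx
      simp [insertAfter_cons_self, ih]
      omega
    · simp [insertAfter_cons_of_ne hx, ih, List.count_cons_of_ne hx]
      omega

/-- The index moves by the occurrences of `a` strictly before the first hit; an `a` that is itself
the hit does not count, since `j` comes after it. The formula survives when there is no hit at all.
-/
theorem findIdx_insertAfter {p : Fin m → Bool} (a : Fin m) {j : Fin m} (hj : p j = false)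
    (l : List (Fin m)) :
    (insertAfter a j l).findIdx p = l.findIdx p + (l.take (l.findIdx p)).count a := by
  induction l with
  | nil => rfl
  | cons x l ih =>
    by_cases hx : x = a
    · subst hx
      by_cases hp : p x
      · simp [insertAfter_cons_self, List.findIdx_cons, hp]
      · simp [insertAfter_cons_self, List.findIdx_cons, hp, hj, ih]
        omega
    · by_cases hp : p x
      · simp [insertAfter_cons_of_ne hx, List.findIdx_cons, hp]
      · simp [insertAfter_cons_of_ne hx, List.findIdx_cons, hp, ih, List.count_cons_of_ne hx]
        omega

/-! ### Effect of late insertion on searches. -/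

section Late

variable {T : Table m} {n : ℕ} {a j : Fin m}

theorem chainFrom_linkLate_self (hT : T.IsTable n) (ha : T.content a ≠ none)
    (hj : T.content j = none) (x : ℕ) : (T.linkLate x a j).ChainFrom j [j] := by
  refine .last ?_
  have : j ≠ T.chainEnd a := fun h => hT.content_chainEnd ha (h ▸ hj)
  simp [linkLate, this, hT.link_of_empty j hj]

/-- The only altered link is the null link at the end of the chain through `a`, so a chain either
stops there and gains `j`, or never meets that cell. -/
theorem chainFrom_linkLate (hT : T.IsTable n) (ha : T.content a ≠ none)
    (hj : T.content j = none) (x : ℕ) {c : Fin m} {l : List (Fin m)} (h : T.ChainFrom c l) :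
    (T.linkLate x a j).ChainFrom c (if l.getLastD c = T.chainEnd a then l ++ [j] else l) := by
  have he : T.link (T.chainEnd a) = none := (hT.chainFrom_search a).link_getLastD a
  induction h with
  | @last c hc =>
    by_cases hce : c = T.chainEnd a
    · simp only [List.getLastD_cons, List.getLastD_nil, if_pos hce]
      exact .cons (by simp [linkLate, hce]) (chainFrom_linkLate_self hT ha hj x)
    · simp only [List.getLastD_cons, List.getLastD_nil, if_neg hce]
      exact .last (by simp [linkLate, hce, hc])
  | @cons c c' l hc hl ih =>
    have hce : c ≠ T.chainEnd a := by
      rintro rfl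
      simp [he] at hc
    have hlink : (T.linkLate x a j).link c = some c' := by simp [linkLate, hce, hc]
    rw [List.getLastD_cons, hl.getLastD_eq c c']
    have := ChainFrom.cons hlink ih
    split_ifs with h
    · rwa [if_pos h] at this
    · rwa [if_neg h] at this

theorem search_linkLate_self (hT : T.IsTable n) (ha : T.content a ≠ none)
    (hj : T.content j = none) (x : ℕ) : (T.linkLate x a j).search j = [j] :=
  (chainFrom_linkLate_self hT ha hj x).search_eq

theorem search_linkLate (hT : T.IsTable n) (ha : T.content a ≠ none)
    (hj : T.content j = none) (x : ℕ) (c : Fin m) :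
    (T.linkLate x a j).search c =
      if T.chainEnd c = T.chainEnd a then T.search c ++ [j] else T.search c :=
  (chainFrom_linkLate hT ha hj x (hT.chainFrom_search c)).search_eq

theorem chainEnd_linkLate_self (hT : T.IsTable n) (ha : T.content a ≠ none)
    (hj : T.content j = none) (x : ℕ) : (T.linkLate x a j).chainEnd j = j := by
  simp [chainEnd, search_linkLate_self hT ha hj]

theorem chainEnd_linkLate (hT : T.IsTable n) (ha : T.content a ≠ none)
    (hj : T.content j = none) (x : ℕ) (c : Fin m) :
    (T.linkLate x a j).chainEnd c =
      if T.chainEnd c = T.chainEnd a then j else T.chainEnd c := by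
  rw [chainEnd, search_linkLate hT ha hj]
  split_ifs
  · simp
  · rfl

end Late

/-! ### Effect of early insertion on searches. -/

section Early

variable {T : Table m} {n : ℕ} {a j : Fin m}

/-- The new cell inherits the old link of `a`, and the cells after `a` keep theirs: none is `a`
because chains do not repeat, and none is `j` because no link leads to an empty cell. -/
theorem chainFrom_linkEarly_tail (hj : T.content j = none)
    (hT : T.IsTable n) (ha : T.content a ≠ none) (x : ℕ) {l : List (Fin m)}
    (h : T.ChainFrom a (a :: l)) : (T.linkEarly x a j).ChainFrom j (j :: l) := by
  have hja : j ≠ a := fun h => ha (h ▸ hj)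
  have hlink : (T.linkEarly x a j).link j = T.link a := by simp [linkEarly, hja]
  have hnd := h.nodup
  cases h with
  | last hc => exact .last (by rw [hlink, hc])
  | @cons _ c' _ hc hl =>
    refine .cons (by rw [hlink, hc]) (hl.congr_link fun y hy => ?_)
    have hya : y ≠ a := fun h => (List.nodup_cons.1 hnd).1 (h ▸ hy)
    have hyj : y ≠ j := fun h =>
      hT.content_of_mem_chain hl (hT.content_of_link _ _ hc) hy (h ▸ hj)
    simp [linkEarly, hya, hyj]

theorem chainFrom_linkEarly (hT : T.IsTable n) (ha : T.content a ≠ none)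
    (hj : T.content j = none) (x : ℕ) {c : Fin m} {l : List (Fin m)} (h : T.ChainFrom c l)
    (hc : c ≠ j) : (T.linkEarly x a j).ChainFrom c (insertAfter a j l) := by
  have hlink : (T.linkEarly x a j).link a = some j := by simp [linkEarly]
  induction h with
  | @last c hcl =>
    by_cases hca : c = a
    · subst hca
      rw [insertAfter_cons_self]
      exact .cons hlink (chainFrom_linkEarly_tail hj hT ha x (.last hcl))
    · rw [insertAfter_cons_of_ne hca]
      exact .last (by simp [linkEarly, hca, hc, hcl])
  | @cons c c' l hcl hl ih =>
    by_cases hca : c = a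
    · subst hca
      have hch := ChainFrom.cons hcl hl
      rw [insertAfter_cons_self, insertAfter_of_not_mem j (List.nodup_cons.1 hch.nodup).1]
      exact .cons hlink (chainFrom_linkEarly_tail hj hT ha x hch)
    · rw [insertAfter_cons_of_ne hca]
      exact .cons (by simp [linkEarly, hca, hc, hcl])
        (ih fun h => hT.content_of_link _ _ hcl (h ▸ hj))

theorem search_linkEarly (hT : T.IsTable n) (ha : T.content a ≠ none)
    (hj : T.content j = none) (x : ℕ) {c : Fin m} (hc : c ≠ j) :
    (T.linkEarly x a j).search c = insertAfter a j (T.search c) :=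
  (chainFrom_linkEarly hT ha hj x (hT.chainFrom_search c) hc).search_eq

theorem exists_search_eq_cons (hT : T.IsTable n) (c : Fin m) : ∃ l, T.search c = c :: l := by
  have h := hT.chainFrom_search c
  generalize T.search c = l at h
  cases h
  · exact ⟨_, rfl⟩
  · exact ⟨_, rfl⟩

theorem search_linkEarly_self (hT : T.IsTable n) (ha : T.content a ≠ none)
    (hj : T.content j = none) (x : ℕ) :
    (T.linkEarly x a j).search j = j :: (T.search a).tail := by
  obtain ⟨l, hl⟩ := exists_search_eq_cons hT a
  have h := hT.chainFrom_search a
  rw [hl] at h ⊢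
  exact (chainFrom_linkEarly_tail hj hT ha x h).search_eq

end Early

/-! ### Insertion preserves the invariants. -/

theorem IsTable.put {T : Table m} {n : ℕ} (hT : T.IsTable n) {a : Fin m}
    (ha : T.content a = none) : (T.put n a).IsTable (n + 1) where
  chain c := by
    obtain ⟨l, hl⟩ := hT.chain c
    exact ⟨l, hl.congr_link fun _ _ => rfl⟩
  link_of_empty c hc := by
    refine hT.link_of_empty c ?_
    by_cases hca : c = a
    · exact hca ▸ ha
    · simpa [Table.put, hca] using hc
  content_of_link c c' h := by
    have := hT.content_of_link c c' h
    by_cases hca : c' = a <;> simp [Table.put, hca, this]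
  content_lt c k h := by
    by_cases hca : c = a
    · simp [Table.put, hca] at h
      omega
    · have := hT.content_lt c k (by simpa [Table.put, hca] using h)
      omega
  card_occupied := by
    rw [occupied_update (T := T) rfl, Finset.card_insert_of_notMem (not_mem_occupied ha),
      hT.card_occupied]

theorem content_update_ne_none {T : Table m} {j c : Fin m} {n : ℕ} (hc : T.content c ≠ none) :
    Function.update T.content j (some n) c ≠ none := by
  by_cases h : c = j <;> simp [h, hc]

theorem content_of_update_eq_none {T : Table m} {j c : Fin m} {n : ℕ}
    (hc : Function.update T.content j (some n) c = none) : c ≠ j ∧ T.content c = none := by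
  by_cases h : c = j
  · simp [h] at hc
  · exact ⟨h, by simpa [h] using hc⟩

theorem content_update_lt {T : Table m} {j c : Fin m} {n k : ℕ} (hT : T.IsTable n)
    (hc : Function.update T.content j (some n) c = some k) : k < n + 1 := by
  by_cases h : c = j
  · simp [h] at hc
    omega
  · have := hT.content_lt c k (by simpa [h] using hc)
    omega

theorem IsTable.linkLate {T : Table m} {n : ℕ} (hT : T.IsTable n) {a j : Fin m}
    (ha : T.content a ≠ none) (hj : T.content j = none) :
    (T.linkLate n a j).IsTable (n + 1) where
  chain c := ⟨_, chainFrom_linkLate hT ha hj n (hT.chainFrom_search c)⟩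
  link_of_empty c hc := by
    obtain ⟨-, hc⟩ := content_of_update_eq_none hc
    have : c ≠ T.chainEnd a := fun h => hT.content_chainEnd ha (h ▸ hc)
    simp [Table.linkLate, this, hT.link_of_empty c hc]
  content_of_link c c' h := by
    by_cases hc : c = T.chainEnd a
    · obtain rfl : j = c' := by simpa [Table.linkLate, hc] using h
      simp [Table.linkLate]
    · exact content_update_ne_none
        (hT.content_of_link c c' (by simpa [Table.linkLate, hc] using h))
  content_lt c k h := content_update_lt hT h
  card_occupied := by
    rw [occupied_update (T := T) rfl, Finset.card_insert_of_notMem (not_mem_occupied hj),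
      hT.card_occupied]

theorem IsTable.linkEarly {T : Table m} {n : ℕ} (hT : T.IsTable n) {a j : Fin m}
    (ha : T.content a ≠ none) (hj : T.content j = none) :
    (T.linkEarly n a j).IsTable (n + 1) where
  chain c := by
    by_cases hc : c = j
    · subst hc
      obtain ⟨l, hl⟩ := exists_search_eq_cons hT a
      exact ⟨_, chainFrom_linkEarly_tail hj hT ha n (hl ▸ hT.chainFrom_search a)⟩
    · exact ⟨_, chainFrom_linkEarly hT ha hj n (hT.chainFrom_search c) hc⟩
  link_of_empty c hc := by
    obtain ⟨hcj, hc⟩ := content_of_update_eq_none hc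
    have : c ≠ a := fun h => ha (h ▸ hc)
    simp [Table.linkEarly, this, hcj, hT.link_of_empty c hc]
  content_of_link c c' h := by
    by_cases hca : c = a
    · obtain rfl : j = c' := by simpa [Table.linkEarly, hca] using h
      simp [Table.linkEarly]
    · refine content_update_ne_none ?_
      by_cases hcj : c = j
      · exact hT.content_of_link a c' (by simpa [Table.linkEarly, hca, hcj, hcj ▸ hca] using h)
      · exact hT.content_of_link c c' (by simpa [Table.linkEarly, hca, hcj] using h)
  content_lt c k h := content_update_lt hT h
  card_occupied := by
    rw [occupied_update (T := T) rfl, Finset.card_insert_of_notMem (not_mem_occupied hj),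
      hT.card_occupied]

theorem IsTable.insert {T : Table m} {n : ℕ} (hT : T.IsTable n) (hn : n < m) (Ξ : Policy)
    (a : Fin m) : (T.insert Ξ n a).IsTable (n + 1) := by
  by_cases ha : T.content a = none
  · rw [insert_of_empty Ξ n ha]
    exact hT.put ha
  · cases Ξ with
    | late =>
      obtain ⟨j, hj, h⟩ := insert_late n ha (hT.emptyCells_nonempty hn)
      rw [h]
      exact hT.linkLate ha hj
    | early =>
      obtain ⟨j, hj, h⟩ := insert_early n ha (hT.emptyCells_nonempty hn)
      rw [h]
      exact hT.linkEarly ha hj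

end Table

end CoalescedHashing

/-! ### Weight, pairs and displacement under a single insertion. -/

namespace CoalescedHashing

namespace Table

variable {m : ℕ}

/-- The total length of the searches that start at occupied cells. -/
def weight (T : Table m) : ℕ := ∑ c ∈ T.occupied, (T.search c).length

/-- The occupied cells in the chain through `a`. -/
def chainCells (T : Table m) (a : Fin m) : Finset (Fin m) :=
  {c ∈ T.occupied | T.chainEnd c = T.chainEnd a}

/-- The number of pairs of occupied cells that lie in the same chain. -/
def pairs (T : Table m) : ℕ := ∑ a ∈ T.occupied, (T.chainCells a).card

/-- The number of links followed from cell `a` until item `k` is found. -/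
def disp (T : Table m) (k : ℕ) (a : Fin m) : ℕ :=
  (T.search a).findIdx fun c => T.content c == some k

section

variable {T : Table m} {n k : ℕ} {a b j : Fin m}

theorem content_update_beq (hj : T.content j = none) (hk : k < n) :
    (fun c => Function.update T.content j (some n) c == some k) =
      fun c => T.content c == some k := by
  funext c
  by_cases hc : c = j
  · subst hc
    have : n ≠ k := by omega
    simp [hj, this]
  · simp [hc]

theorem countP_search_eq_length (hT : T.IsTable n) (ha : T.content a ≠ none) :
    (T.search a).countP (fun x => T.content x != none) = (T.search a).length := by
  rw [List.countP_eq_length]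
  intro x hx
  simpa using hT.content_of_mem_search ha hx

theorem sum_countP_search (hT : T.IsTable n) :
    ∑ c, (T.search c).countP (fun x => T.content x != none) = T.weight := by
  rw [weight, ← Finset.sum_subset (Finset.subset_univ T.occupied)]
  · refine Finset.sum_congr rfl fun c hc => ?_
    exact countP_search_eq_length hT (mem_occupied.1 hc)
  · intro c _ hc
    have hc : T.content c = none := by simpa [mem_occupied] using hc
    simp [hT.search_of_empty hc, hc]

theorem weight_put (hT : T.IsTable n) (ha : T.content a = none) (x : ℕ) :
    (T.put x a).weight = T.weight + 1 := by
  rw [weight, occupied_update (T := T) rfl, Finset.sum_insert (not_mem_occupied ha)]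
  simp only [search_put, hT.search_of_empty ha, weight]
  simp [add_comm]

theorem weight_linkLate (hT : T.IsTable n) (ha : T.content a ≠ none) (hj : T.content j = none)
    (x : ℕ) : (T.linkLate x a j).weight = T.weight + (T.chainCells a).card + 1 := by
  rw [weight, occupied_update (T := T) rfl, Finset.sum_insert (not_mem_occupied hj),
    search_linkLate_self hT ha hj, weight, chainCells, Finset.card_filter,
    ← Finset.sum_add_distrib, add_comm]
  congr 1
  refine Finset.sum_congr rfl fun c _ => ?_
  rw [search_linkLate hT ha hj]
  split_ifs <;> simp

/-- A search grows by one exactly when it passes through `a`; the search from `j` is that from `a`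
with its first cell replaced, hence equally long. -/
theorem weight_linkEarly (hT : T.IsTable n) (ha : T.content a ≠ none) (hj : T.content j = none)
    (x : ℕ) : (T.linkEarly x a j).weight =
      T.weight + ∑ c ∈ T.occupied, (T.search c).count a + (T.search a).length := by
  rw [weight, occupied_update (T := T) rfl, Finset.sum_insert (not_mem_occupied hj),
    search_linkEarly_self hT ha hj, weight, ← Finset.sum_add_distrib, add_comm]
  congr 1
  · refine Finset.sum_congr rfl fun c hc => ?_
    rw [search_linkEarly hT ha hj, length_insertAfter]
    rintro rfl
    exact mem_occupied.1 hc hj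
  · obtain ⟨l, hl⟩ := exists_search_eq_cons hT a
    simp [hl]

theorem pairs_put (hT : T.IsTable n) (ha : T.content a = none) (x : ℕ) :
    (T.put x a).pairs = T.pairs + 1 := by
  have hne : ∀ c ∈ T.occupied, T.chainEnd c ≠ a := fun c hc h =>
    hT.content_chainEnd (mem_occupied.1 hc) (h ▸ ha)
  have hocc : (T.put x a).occupied = Insert.insert a T.occupied := occupied_update rfl
  simp only [pairs, chainCells, Finset.card_filter, hocc, chainEnd_put,
    Finset.sum_insert (not_mem_occupied ha), hT.chainEnd_of_empty ha]
  rw [Finset.sum_add_distrib, Finset.sum_eq_zero fun c hc => if_neg (hne c hc),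
    Finset.sum_eq_zero fun c hc => if_neg (hne c hc).symm]
  simp [add_comm]

/-- The cell `j` joins the class of `a`: pairing it with each old member in both orders gives twice
the class size, and pairing it with itself gives 1. -/
theorem pairs_linkLate (hT : T.IsTable n) (ha : T.content a ≠ none) (hj : T.content j = none)
    (x : ℕ) : (T.linkLate x a j).pairs = T.pairs + 2 * (T.chainCells a).card + 1 := by
  have hne : ∀ c ∈ T.occupied, T.chainEnd c ≠ j := fun c hc h =>
    hT.content_chainEnd (mem_occupied.1 hc) (h ▸ hj)
  have hocc : (T.linkLate x a j).occupied = Insert.insert j T.occupied := occupied_update rfl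
  have hend : ∀ c ∈ T.occupied,
      ((T.linkLate x a j).chainEnd c = j ↔ T.chainEnd c = T.chainEnd a) := by
    intro c hc
    rw [chainEnd_linkLate hT ha hj]
    split_ifs with h <;> simp [h, hne c hc]
  have hpair : ∀ c ∈ T.occupied, ∀ d ∈ T.occupied,
      ((T.linkLate x a j).chainEnd d = (T.linkLate x a j).chainEnd c ↔
        T.chainEnd d = T.chainEnd c) := by
    intro c hc d hd
    rw [chainEnd_linkLate hT ha hj, chainEnd_linkLate hT ha hj]
    have h₁ := hne c hc
    have h₂ := hne d hd
    split_ifs <;> grind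
  simp only [pairs, chainCells, Finset.card_filter, hocc,
    Finset.sum_insert (not_mem_occupied hj), chainEnd_linkLate_self hT ha hj]
  rw [Finset.sum_add_distrib]
  have e₁ : ∑ c ∈ T.occupied, (if (T.linkLate x a j).chainEnd c = j then 1 else 0) =
      ∑ c ∈ T.occupied, (if T.chainEnd c = T.chainEnd a then 1 else 0) :=
    Finset.sum_congr rfl fun c hc => by simp only [hend c hc]
  have e₂ : ∑ c ∈ T.occupied, (if j = (T.linkLate x a j).chainEnd c then 1 else 0) =
      ∑ c ∈ T.occupied, (if T.chainEnd c = T.chainEnd a then 1 else 0) :=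
    Finset.sum_congr rfl fun c hc => by simp only [eq_comm (a := j), hend c hc]
  have e₃ : ∑ c ∈ T.occupied, ∑ d ∈ T.occupied,
      (if (T.linkLate x a j).chainEnd d = (T.linkLate x a j).chainEnd c then 1 else 0) =
      ∑ c ∈ T.occupied, ∑ d ∈ T.occupied, (if T.chainEnd d = T.chainEnd c then 1 else 0) :=
    Finset.sum_congr rfl fun c hc => Finset.sum_congr rfl fun d hd => by
      simp only [hpair c hc d hd]
  rw [e₁, e₂, e₃, if_pos trivial]
  ring

/-- The invariant says that the occupied cells fall into simple paths: a path of ℓ cells has weight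
ℓ(ℓ + 1)/2 and ℓ² ordered pairs. Tracking increments avoids decomposing the table into paths. -/
theorem two_mul_weight_insert_late (hT : T.IsTable n) (hn : n < m)
    (h : 2 * T.weight = n + T.pairs) (a : Fin m) :
    2 * (T.insert .late n a).weight = n + 1 + (T.insert .late n a).pairs := by
  by_cases ha : T.content a = none
  · rw [insert_of_empty .late n ha, weight_put hT ha, pairs_put hT ha]
    omega
  · obtain ⟨j, hj, hi⟩ := insert_late n ha (hT.emptyCells_nonempty hn)
    rw [hi, weight_linkLate hT ha hj, pairs_linkLate hT ha hj]
    omega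

theorem sum_count_eq_length {s : Finset (Fin m)} {l : List (Fin m)} (h : ∀ x ∈ l, x ∈ s) :
    ∑ a ∈ s, l.count a = l.length := by
  have := Multiset.sum_count_eq_card (s := s) (m := (l : Multiset (Fin m))) (by simpa using h)
  simpa using this

theorem sum_sum_count_search (hT : T.IsTable n) :
    ∑ a ∈ T.occupied, ∑ c ∈ T.occupied, (T.search c).count a = T.weight := by
  rw [Finset.sum_comm, weight]
  exact Finset.sum_congr rfl fun c hc => sum_count_eq_length fun x hx =>
    mem_occupied.2 (hT.content_of_mem_search (mem_occupied.1 hc) hx)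

theorem sum_eq_sum_occupied_add (T : Table m) (f : Fin m → ℕ) :
    ∑ a, f a = ∑ a ∈ T.occupied, f a + ∑ a ∈ T.emptyCells, f a :=
  (Finset.sum_compl_add_sum T.emptyCells f).symm

theorem sum_weight_insert_late (hT : T.IsTable n) (hn : n < m)
    (h : 2 * T.weight = n + T.pairs) :
    ∑ a, (T.insert .late n a).weight = (m + 2) * T.weight + (m - n) := by
  have h₁ : ∀ a ∈ T.occupied, (T.insert .late n a).weight =
      T.weight + (T.chainCells a).card + 1 := by
    intro a ha
    obtain ⟨j, hj, hi⟩ := insert_late n (mem_occupied.1 ha) (hT.emptyCells_nonempty hn)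
    rw [hi, weight_linkLate hT (mem_occupied.1 ha) hj]
  have h₂ : ∀ a ∈ T.emptyCells, (T.insert .late n a).weight = T.weight + 1 := by
    intro a ha
    rw [insert_of_empty .late n (mem_emptyCells.1 ha), weight_put hT (mem_emptyCells.1 ha)]
  rw [sum_eq_sum_occupied_add T, Finset.sum_congr rfl h₁, Finset.sum_congr rfl h₂]
  simp only [Finset.sum_add_distrib, Finset.sum_const, hT.card_occupied, hT.card_emptyCells,
    smul_eq_mul]
  obtain ⟨k, rfl⟩ : ∃ k, m = n + k := ⟨m - n, by omega⟩
  rw [Nat.add_sub_cancel_left]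
  -- The class sizes summed over occupied addresses are by definition `pairs`, which `h` trades for
  -- twice the weight minus `n`.
  change _ + T.pairs + _ + _ = _
  linarith

theorem sum_weight_insert_early (hT : T.IsTable n) (hn : n < m) :
    ∑ a, (T.insert .early n a).weight = (m + 2) * T.weight + (m - n) := by
  have h₁ : ∀ a ∈ T.occupied, (T.insert .early n a).weight =
      T.weight + ∑ c ∈ T.occupied, (T.search c).count a + (T.search a).length := by
    intro a ha
    obtain ⟨j, hj, hi⟩ := insert_early n (mem_occupied.1 ha) (hT.emptyCells_nonempty hn)
    rw [hi, weight_linkEarly hT (mem_occupied.1 ha) hj]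
  have h₂ : ∀ a ∈ T.emptyCells, (T.insert .early n a).weight = T.weight + 1 := by
    intro a ha
    rw [insert_of_empty .early n (mem_emptyCells.1 ha), weight_put hT (mem_emptyCells.1 ha)]
  rw [sum_eq_sum_occupied_add T, Finset.sum_congr rfl h₁, Finset.sum_congr rfl h₂]
  rw [Finset.sum_add_distrib, Finset.sum_add_distrib, sum_sum_count_search hT]
  simp only [Finset.sum_const, hT.card_occupied, hT.card_emptyCells, smul_eq_mul]
  obtain ⟨k, rfl⟩ : ∃ k, m = n + k := ⟨m - n, by omega⟩
  rw [Nat.add_sub_cancel_left]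
  change _ + T.weight + _ = _
  ring

/-! ### Displacements of old and new items. -/

theorem disp_put (ha : T.content a = none) (hk : k < n) : (T.put n a).disp k b = T.disp k b := by
  rw [disp, search_put, disp]
  exact congrArg (fun p => List.findIdx p (T.search b)) (content_update_beq ha hk)

theorem disp_put_self (hT : T.IsTable n) (ha : T.content a = none) :
    (T.put n a).disp n a = 0 := by
  rw [disp, search_put, hT.search_of_empty ha]
  simp [put]

/-- Appending a cell cannot move the first hit. The hypothesis `hb` is essential: for an item not
found, `findIdx` returns the list length, which would grow. -/
theorem disp_linkLate (hT : T.IsTable n) (ha : T.content a ≠ none) (hj : T.content j = none)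
    (hk : k < n) (hb : ∃ c ∈ T.search b, T.content c = some k) :
    (T.linkLate n a j).disp k b = T.disp k b := by
  rw [disp, search_linkLate hT ha hj]
  simp only [linkLate, disp]
  rw [content_update_beq hj hk]
  split_ifs
  · rw [List.findIdx_append, if_pos]
    obtain ⟨c, hc, hck⟩ := hb
    exact List.findIdx_lt_length_of_exists ⟨c, hc, by simp [hck]⟩
  · rfl

theorem disp_linkLate_self (hT : T.IsTable n) (ha : T.content a ≠ none)
    (hj : T.content j = none) : (T.linkLate n a j).disp n a = (T.search a).length := by
  have hlt : (T.search a).findIdx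
      (fun c => Function.update T.content j (some n) c == some n) = (T.search a).length := by
    rw [List.findIdx_eq_length]
    intro c hc
    have hcj : c ≠ j := fun h => hT.content_of_mem_search ha hc (h ▸ hj)
    have : T.content c ≠ some n := fun h => lt_irrefl _ (hT.content_lt c n h)
    simp [hcj, this]
  rw [disp, search_linkLate hT ha hj, if_pos rfl]
  simp only [linkLate]
  rw [List.findIdx_append, hlt]
  simp

theorem disp_linkEarly (hT : T.IsTable n) (ha : T.content a ≠ none) (hj : T.content j = none)
    (hk : k < n) (hb : T.content b ≠ none) :
    (T.linkEarly n a j).disp k b =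
      T.disp k b + ((T.search b).take (T.disp k b)).count a := by
  have hbj : b ≠ j := fun h => hb (h ▸ hj)
  rw [disp, search_linkEarly hT ha hj n hbj]
  simp only [linkEarly, disp]
  rw [content_update_beq hj hk]
  exact findIdx_insertAfter a (by simp [hj]) _

theorem disp_linkEarly_self (hT : T.IsTable n) (ha : T.content a ≠ none)
    (hj : T.content j = none) : (T.linkEarly n a j).disp n a = 1 := by
  have haj : a ≠ j := fun h => ha (h ▸ hj)
  have : (T.content a == some n) = false := by
    simpa using fun h => lt_irrefl _ (hT.content_lt a n h)
  obtain ⟨l, hl⟩ := exists_search_eq_cons hT a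
  rw [disp, search_linkEarly hT ha hj n haj, hl, insertAfter_cons_self]
  simp [linkEarly, List.findIdx_cons, haj, this]

theorem disp_le (T : Table m) (k : ℕ) (a : Fin m) : T.disp k a ≤ (T.search a).length :=
  List.findIdx_le_length

theorem content_insert_ne_none (Ξ : Policy) {c : Fin m} (hc : T.content c ≠ none) :
    (T.insert Ξ n a).content c ≠ none := by
  unfold insert
  split_ifs
  · exact content_update_ne_none hc
  · exact content_update_ne_none hc
  · exact hc

theorem content_insert_self (Ξ : Policy) : (T.insert Ξ n a).content a ≠ none := by
  by_cases ha : T.content a = none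
  · rw [insert_of_empty Ξ n ha]
    simp [put]
  · exact content_insert_ne_none Ξ ha

theorem exists_mem_search_insert_late (hT : T.IsTable n) (hn : n < m)
    (hb : ∃ c ∈ T.search b, T.content c = some k) (a : Fin m) :
    ∃ c ∈ (T.insert .late n a).search b, (T.insert .late n a).content c = some k := by
  obtain ⟨c, hc, hck⟩ := hb
  by_cases ha : T.content a = none
  · rw [insert_of_empty .late n ha, search_put]
    have : c ≠ a := by
      rintro rfl
      simp [ha] at hck
    exact ⟨c, hc, by simp [put, this, hck]⟩
  · obtain ⟨j, hj, hi⟩ := insert_late n ha (hT.emptyCells_nonempty hn)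
    rw [hi, search_linkLate hT ha hj]
    have : c ≠ j := by
      rintro rfl
      simp [hj] at hck
    refine ⟨c, ?_, by simp [linkLate, this, hck]⟩
    split_ifs <;> simp [hc]

theorem exists_mem_search_insert_late_self (hT : T.IsTable n) (hn : n < m) (a : Fin m) :
    ∃ c ∈ (T.insert .late n a).search a, (T.insert .late n a).content c = some n := by
  by_cases ha : T.content a = none
  · rw [insert_of_empty .late n ha, search_put, hT.search_of_empty ha]
    exact ⟨a, by simp, by simp [put]⟩
  · obtain ⟨j, hj, hi⟩ := insert_late n ha (hT.emptyCells_nonempty hn)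
    rw [hi, search_linkLate hT ha hj, if_pos rfl]
    exact ⟨j, by simp, by simp [linkLate]⟩

theorem disp_insert_late (hT : T.IsTable n) (hn : n < m) (hk : k < n)
    (hb : ∃ c ∈ T.search b, T.content c = some k) (a : Fin m) :
    (T.insert .late n a).disp k b = T.disp k b := by
  by_cases ha : T.content a = none
  · rw [insert_of_empty .late n ha, disp_put ha hk]
  · obtain ⟨j, hj, hi⟩ := insert_late n ha (hT.emptyCells_nonempty hn)
    rw [hi, disp_linkLate hT ha hj hk hb]

theorem sum_disp_insert_late_self (hT : T.IsTable n) (hn : n < m) :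
    ∑ a, (T.insert .late n a).disp n a = T.weight := by
  have h₁ : ∀ a ∈ T.occupied, (T.insert .late n a).disp n a = (T.search a).length := by
    intro a ha
    obtain ⟨j, hj, hi⟩ := insert_late n (mem_occupied.1 ha) (hT.emptyCells_nonempty hn)
    rw [hi, disp_linkLate_self hT (mem_occupied.1 ha) hj]
  have h₂ : ∀ a ∈ T.emptyCells, (T.insert .late n a).disp n a = 0 := by
    intro a ha
    rw [insert_of_empty .late n (mem_emptyCells.1 ha), disp_put_self hT (mem_emptyCells.1 ha)]
  rw [sum_eq_sum_occupied_add T, Finset.sum_congr rfl h₁, Finset.sum_congr rfl h₂]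
  simp [weight]

/-- The addresses that push the item back are the cells ahead of it on its search path, as many as
its displacement; hence the factor `m + 1`. Unlike the late case, no proof that the item is found is
needed, since the default value of `findIdx` obeys the same rule. -/
theorem sum_disp_insert_early (hT : T.IsTable n) (hn : n < m) (hk : k < n)
    (hb : T.content b ≠ none) :
    ∑ a, (T.insert .early n a).disp k b = (m + 1) * T.disp k b := by
  have h₁ : ∀ a ∈ T.occupied, (T.insert .early n a).disp k b =
      T.disp k b + ((T.search b).take (T.disp k b)).count a := by
    intro a ha
    obtain ⟨j, hj, hi⟩ := insert_early n (mem_occupied.1 ha) (hT.emptyCells_nonempty hn)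
    rw [hi, disp_linkEarly hT (mem_occupied.1 ha) hj hk hb]
  have h₂ : ∀ a ∈ T.emptyCells, (T.insert .early n a).disp k b = T.disp k b := by
    intro a ha
    rw [insert_of_empty .early n (mem_emptyCells.1 ha), disp_put (mem_emptyCells.1 ha) hk]
  rw [sum_eq_sum_occupied_add T, Finset.sum_congr rfl h₁, Finset.sum_congr rfl h₂,
    Finset.sum_add_distrib, sum_count_eq_length fun x hx => mem_occupied.2
      (hT.content_of_mem_search hb (List.mem_of_mem_take hx)),
    List.length_take_of_le (disp_le T k b)]
  simp only [Finset.sum_const, hT.card_occupied, hT.card_emptyCells, smul_eq_mul]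
  obtain ⟨k, rfl⟩ : ∃ k, m = n + k := ⟨m - n, by omega⟩
  rw [Nat.add_sub_cancel_left]
  ring

theorem sum_disp_insert_early_self (hT : T.IsTable n) (hn : n < m) :
    ∑ a, (T.insert .early n a).disp n a = n := by
  have h₁ : ∀ a ∈ T.occupied, (T.insert .early n a).disp n a = 1 := by
    intro a ha
    obtain ⟨j, hj, hi⟩ := insert_early n (mem_occupied.1 ha) (hT.emptyCells_nonempty hn)
    rw [hi, disp_linkEarly_self hT (mem_occupied.1 ha) hj]
  have h₂ : ∀ a ∈ T.emptyCells, (T.insert .early n a).disp n a = 0 := by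
    intro a ha
    rw [insert_of_empty .early n (mem_emptyCells.1 ha), disp_put_self hT (mem_emptyCells.1 ha)]
  rw [sum_eq_sum_occupied_add T, Finset.sum_congr rfl h₁, Finset.sum_congr rfl h₂]
  simp [hT.card_occupied]

end

end Table

end CoalescedHashing

/-! ### Recurrences over all hash sequences and their solutions. -/

namespace CoalescedHashing

open MeasureTheory ProbabilityTheory

section Build

variable {m n : ℕ}

theorem isTable_build (Ξ : Policy) (hn : n ≤ m) (h : Fin n → Fin m) :
    (build Ξ n h).IsTable n := by
  induction n with
  | zero => exact Table.isTable_empty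
  | succ n ih => exact (ih (by omega) _).insert (by omega) Ξ _

theorem content_build_hash (Ξ : Policy) (h : Fin n → Fin m) (i : Fin n) :
    (build Ξ n h).content (h i) ≠ none := by
  induction n with
  | zero => exact i.elim0
  | succ n ih =>
    induction i using Fin.lastCases with
    | last => exact Table.content_insert_self Ξ
    | cast i => exact Table.content_insert_ne_none Ξ (ih (fun i => h i.castSucc) i)

theorem exists_mem_search_build_late (hn : n ≤ m) (h : Fin n → Fin m) (i : Fin n) :
    ∃ c ∈ (build .late n h).search (h i), (build .late n h).content c = some (i : ℕ) := by
  induction n with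
  | zero => exact i.elim0
  | succ n ih =>
    have hT := isTable_build .late (by omega : n ≤ m) fun i => h i.castSucc
    induction i using Fin.lastCases with
    | last => exact Table.exists_mem_search_insert_late_self hT (by omega) _
    | cast i =>
      exact Table.exists_mem_search_insert_late hT (by omega)
        (ih (by omega) (fun i => h i.castSucc) i) _

theorem two_mul_weight_build_late (hn : n ≤ m) (h : Fin n → Fin m) :
    2 * (build .late n h).weight = n + (build .late n h).pairs := by
  induction n with
  | zero => simp [build, Table.weight, Table.pairs, Table.occupied, Table.emptyCells, Table.empty]
  | succ n ih =>
    exact Table.two_mul_weight_insert_late (isTable_build .late (by omega) _) (by omega)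
      (ih (by omega) _) _

theorem build_snoc (Ξ : Policy) (g : Fin n → Fin m) (a : Fin m) :
    build Ξ (n + 1) (Fin.snoc (α := fun _ => Fin m) g a) = (build Ξ n g).insert Ξ n a := by
  simp [build]

/-- Splitting off the last address reduces each total to the one-insertion sums over `a`. -/
theorem sum_hash_succ (F : (Fin (n + 1) → Fin m) → ℕ) :
    ∑ h, F h = ∑ g : Fin n → Fin m, ∑ a : Fin m, F (Fin.snoc (α := fun _ => Fin m) g a) := by
  rw [← (Fin.snocEquiv fun _ => Fin m).sum_comp, Fintype.sum_prod_type, Finset.sum_comm]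
  rfl

theorem sum_unsuccessful (Ξ : Policy) (hn : n ≤ m) (h : Fin n → Fin m) :
    ∑ j, unsuccessful Ξ h j = (build Ξ n h).weight :=
  Table.sum_countP_search (isTable_build Ξ hn h)

theorem displacement_eq (Ξ : Policy) (h : Fin n → Fin m) (i : Fin n) :
    displacement Ξ h i = (build Ξ n h).disp i (h i) := rfl

end Build

/-- The sum of the weights of all tables with `m` cells and `n` items. -/
def weightSum (Ξ : Policy) (m n : ℕ) : ℕ := ∑ h : Fin n → Fin m, (build Ξ n h).weight

/-- The sum of all displacements in all tables with `m` cells and `n` items. -/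
def dispSum (Ξ : Policy) (m n : ℕ) : ℕ := ∑ h : Fin n → Fin m, ∑ i, displacement Ξ h i

section Sums

variable {m n : ℕ}

theorem weightSum_zero (Ξ : Policy) (m : ℕ) : weightSum Ξ m 0 = 0 := by
  simp [weightSum, build, Table.weight, Table.occupied, Table.emptyCells, Table.empty]

theorem dispSum_zero (Ξ : Policy) (m : ℕ) : dispSum Ξ m 0 = 0 := by
  simp [dispSum]

theorem weightSum_succ (Ξ : Policy) (hn : n < m) :
    weightSum Ξ m (n + 1) = (m + 2) * weightSum Ξ m n + (m - n) * m ^ n := by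
  have key : ∀ g : Fin n → Fin m, ∑ a, ((build Ξ n g).insert Ξ n a).weight =
      (m + 2) * (build Ξ n g).weight + (m - n) := by
    intro g
    have hT := isTable_build Ξ hn.le g
    cases Ξ with
    | late => exact Table.sum_weight_insert_late hT hn (two_mul_weight_build_late hn.le g)
    | early => exact Table.sum_weight_insert_early hT hn
  simp only [weightSum, sum_hash_succ, build_snoc, key]
  rw [Finset.sum_add_distrib, ← Finset.mul_sum]
  simp [mul_comm]

theorem sum_displacement_snoc (Ξ : Policy) (g : Fin n → Fin m) (a : Fin m) :
    ∑ i, displacement Ξ (Fin.snoc (α := fun _ => Fin m) g a) i =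
      ∑ i : Fin n, ((build Ξ n g).insert Ξ n a).disp i (g i) +
        ((build Ξ n g).insert Ξ n a).disp n a := by
  simp [Fin.sum_univ_castSucc, displacement_eq, build_snoc]

theorem dispSum_late_succ (hn : n < m) :
    dispSum .late m (n + 1) = m * dispSum .late m n + weightSum .late m n := by
  have key : ∀ g : Fin n → Fin m,
      ∑ a, ∑ i, displacement .late (Fin.snoc (α := fun _ => Fin m) g a) i =
        m * ∑ i, displacement .late g i + (build .late n g).weight := by
    intro g
    have hT := isTable_build .late hn.le g
    simp only [sum_displacement_snoc, Finset.sum_add_distrib,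
      Table.sum_disp_insert_late_self hT hn]
    congr 1
    simp only [Table.disp_insert_late hT hn (Fin.is_lt _)
      (exists_mem_search_build_late hn.le g _), displacement_eq]
    simp
  simp only [dispSum, sum_hash_succ, key, weightSum]
  rw [Finset.sum_add_distrib, ← Finset.mul_sum]

theorem dispSum_early_succ (hn : n < m) :
    dispSum .early m (n + 1) = (m + 1) * dispSum .early m n + n * m ^ n := by
  have key : ∀ g : Fin n → Fin m,
      ∑ a, ∑ i, displacement .early (Fin.snoc (α := fun _ => Fin m) g a) i =
        (m + 1) * ∑ i, displacement .early g i + n := by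
    intro g
    have hT := isTable_build .early hn.le g
    simp only [sum_displacement_snoc, Finset.sum_add_distrib,
      Table.sum_disp_insert_early_self hT hn]
    rw [Finset.sum_comm, Finset.mul_sum]
    congr 1
    exact Finset.sum_congr rfl fun i _ =>
      Table.sum_disp_insert_early hT hn i.is_lt (content_build_hash .early g i)
  simp only [dispSum, sum_hash_succ, key]
  rw [Finset.sum_add_distrib, ← Finset.mul_sum]
  simp [mul_comm]

theorem four_mul_weightSum (Ξ : Policy) (hn : n ≤ m) :
    4 * (weightSum Ξ m n : ℝ) = m * (m + 2) ^ n - m * m ^ n + 2 * n * m ^ n := by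
  induction n with
  | zero => simp [weightSum_zero]
  | succ n ih =>
    have ih := ih (by omega)
    rw [weightSum_succ Ξ (by omega)]
    push_cast [Nat.cast_sub (by omega : n ≤ m)]
    linear_combination ((m : ℝ) + 2) * ih

theorem eight_mul_dispSum_late (hn : n ≤ m) :
    8 * m * (dispSum .late m n : ℝ) =
      m ^ 2 * (m + 2) ^ n - m ^ 2 * m ^ n - 2 * n * m * m ^ n + 2 * n * (n - 1) * m ^ n := by
  induction n with
  | zero => simp [dispSum_zero]
  | succ n ih =>
    have ih := ih (by omega)
    rw [dispSum_late_succ (by omega)]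
    push_cast
    linear_combination (m : ℝ) * ih + 2 * m * four_mul_weightSum .late (by omega : n ≤ m)

theorem dispSum_early_eq (hn : n ≤ m) :
    (dispSum .early m n : ℝ) = m * (m + 1) ^ n - (n + m) * m ^ n := by
  induction n with
  | zero => simp [dispSum_zero]
  | succ n ih =>
    have ih := ih (by omega)
    rw [dispSum_early_succ (by omega)]
    push_cast
    linear_combination ((m : ℝ) + 1) * ih

end Sums

/-! ### Exact means for finite tables. -/

section Means

theorem integral_prod_uniformOn {A B : Type*} [Fintype A] [Fintype B] [Nonempty A] [Nonempty B]
    [MeasurableSpace A] [MeasurableSpace B] [MeasurableSingletonClass A]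
    [MeasurableSingletonClass B] (f : A × B → ℝ) :
    ∫ ω, f ω ∂((uniformOn (Set.univ : Set A)).prod (uniformOn (Set.univ : Set B))) =
      (∑ a, ∑ b, f (a, b)) / (Fintype.card A * Fintype.card B) := by
  rw [integral_fintype .of_finite, Fintype.sum_prod_type, Finset.sum_div]
  refine Finset.sum_congr rfl fun a _ => ?_
  rw [Finset.sum_div]
  refine Finset.sum_congr rfl fun b _ => ?_
  rw [← Set.singleton_prod_singleton, measureReal_prod_prod]
  simp only [Measure.real, uniformOn_univ, Measure.count_singleton, ENNReal.toReal_div,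
    ENNReal.toReal_one, ENNReal.toReal_natCast, smul_eq_mul]
  field_simp

variable {m n : ℕ}

theorem meanUnsuccessful_eq (Ξ : Policy) (hn : 0 < n) (hnm : n ≤ m) :
    meanUnsuccessful Ξ m n = 1 / 4 * ((1 + 2 / (m : ℝ)) ^ n - 1) + (n : ℝ) / m / 2 := by
  have : NeZero m := ⟨by omega⟩
  have hm : (m : ℝ) ≠ 0 := by exact_mod_cast NeZero.ne m
  rw [meanUnsuccessful, tableLaw, integral_prod_uniformOn]
  have h := four_mul_weightSum Ξ hnm
  have e : ∑ a : Fin n → Fin m, ∑ b, (unsuccessful Ξ (a, b).1 (a, b).2 : ℝ) =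
      weightSum Ξ m n := by
    rw [weightSum]
    push_cast
    exact Finset.sum_congr rfl fun h _ => by
      rw [← sum_unsuccessful Ξ hnm h]
      push_cast
      rfl
  rw [e, one_add_div hm, div_pow]
  simp only [Fintype.card_fun, Fintype.card_fin]
  push_cast
  field_simp
  linear_combination 2 * h

theorem meanDisplacement_eq (Ξ : Policy) (hn : 0 < n) (hnm : n ≤ m) :
    meanDisplacement Ξ m n = dispSum Ξ m n / (m ^ n * n) := by
  have : NeZero m := ⟨by omega⟩
  have : NeZero n := ⟨by omega⟩
  rw [meanDisplacement, tableLaw, integral_prod_uniformOn]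
  simp [dispSum]

theorem meanDisplacement_late_eq (hn : 0 < n) (hnm : n ≤ m) :
    meanDisplacement .late m n =
      1 / 8 * ((m : ℝ) / n * ((1 + 2 / (m : ℝ)) ^ n - 1)) + (n : ℝ) / m / 4 - 1 / (m : ℝ) / 4
        - 1 / 4 := by
  have hm : (m : ℝ) ≠ 0 := by exact_mod_cast (hn.trans_le hnm).ne'
  have hn' : (n : ℝ) ≠ 0 := by exact_mod_cast hn.ne'
  have h := eight_mul_dispSum_late hnm
  rw [meanDisplacement_eq .late hn hnm, one_add_div hm, div_pow]
  field_simp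
  linear_combination 4 * h

theorem meanDisplacement_early_eq (hn : 0 < n) (hnm : n ≤ m) :
    meanDisplacement .early m n = (m : ℝ) / n * ((1 + 1 / (m : ℝ)) ^ n - 1) - 1 := by
  have hm : (m : ℝ) ≠ 0 := by exact_mod_cast (hn.trans_le hnm).ne'
  have hn' : (n : ℝ) ≠ 0 := by exact_mod_cast hn.ne'
  rw [meanDisplacement_eq .early hn hnm, one_add_div hm, div_pow, dispSum_early_eq hnm]
  field_simp
  ring

end Means

end CoalescedHashing

/-! ### Limits of the exact formulas. -/

namespace CoalescedHashing

open MeasureTheory ProbabilityTheory Filter Topology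

section Asymptotics

theorem tendsto_exp_sub_one_div : Tendsto (fun y : ℝ => (Real.exp y - 1) / y) (𝓝[≠] 0) (𝓝 1) := by
  have h := (Real.hasDerivAt_exp 0).tendsto_slope_zero
  simpa [div_eq_inv_mul] using h

variable {α : ℝ} {m n : ℕ → ℕ}

theorem tendsto_mul_log (hm : Tendsto m atTop atTop) (x : ℝ) :
    Tendsto (fun j => (m j : ℝ) * Real.log (1 + x / m j)) atTop (𝓝 x) :=
  (Real.tendsto_mul_log_one_add_div_atTop x).comp (tendsto_natCast_atTop_atTop.comp hm)

theorem one_add_div_pow_eq_exp {x : ℝ} (hx : 0 < x) {m : ℕ} (hm : 0 < m) (n : ℕ) :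
    (1 + x / m) ^ n = Real.exp ((n : ℝ) / m * (m * Real.log (1 + x / m))) := by
  have hm : (0 : ℝ) < m := by exact_mod_cast hm
  have : (n : ℝ) / m * (m * Real.log (1 + x / m)) = n * Real.log (1 + x / m) := by
    field_simp
  rw [this, Real.exp_nat_mul, Real.exp_log (by positivity)]

theorem tendsto_one_add_div_pow (hm : Tendsto m atTop atTop) (hnm : ∀ j, 0 < n j ∧ n j ≤ m j)
    (hlim : Tendsto (fun j => (n j : ℝ) / (m j : ℝ)) atTop (𝓝 α)) {x : ℝ} (hx : 0 < x) :
    Tendsto (fun j => (1 + x / (m j : ℝ)) ^ n j) atTop (𝓝 (Real.exp (x * α))) := by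
  have h := (Real.continuous_exp.tendsto _).comp (hlim.mul (tendsto_mul_log hm x))
  rw [mul_comm α x] at h
  refine h.congr fun j => ?_
  rw [one_add_div_pow_eq_exp hx ((hnm j).1.trans_le (hnm j).2)]
  rfl

/-- For α = 0 the prefactor `m/n` diverges. Writing the power as e^y with y = n log(1 + x/m), the
expression is (e^y - 1)/y times m log(1 + x/m), where y tends to 0 without vanishing. -/
theorem tendsto_div_mul_one_add_div_pow_sub_one (hm : Tendsto m atTop atTop)
    (hnm : ∀ j, 0 < n j ∧ n j ≤ m j)
    (hlim : Tendsto (fun j => (n j : ℝ) / (m j : ℝ)) atTop (𝓝 α)) {x : ℝ} (hx : 0 < x) :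
    Tendsto (fun j => (m j : ℝ) / n j * ((1 + x / (m j : ℝ)) ^ n j - 1)) atTop
      (𝓝 (if α = 0 then x else (Real.exp (x * α) - 1) / α)) := by
  split_ifs with hα
  · subst hα
    have hy := hlim.mul (tendsto_mul_log hm x)
    rw [zero_mul] at hy
    have hlog : ∀ j, 0 < Real.log (1 + x / (m j : ℝ)) := fun j => by
      have : (0 : ℝ) < m j := by exact_mod_cast (hnm j).1.trans_le (hnm j).2
      refine Real.log_pos ?_
      have : 0 < x / (m j : ℝ) := by positivity
      linarith
    have hpos : ∀ j, (0 : ℝ) < n j ∧ (0 : ℝ) < m j := fun j =>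
      ⟨by exact_mod_cast (hnm j).1, by exact_mod_cast (hnm j).1.trans_le (hnm j).2⟩
    have hy' : Tendsto (fun j => (n j : ℝ) / m j * (m j * Real.log (1 + x / m j))) atTop
        (𝓝[≠] 0) := tendsto_nhdsWithin_iff.2 ⟨hy, Eventually.of_forall fun j =>
      (mul_pos (div_pos (hpos j).1 (hpos j).2) (mul_pos (hpos j).2 (hlog j))).ne'⟩
    have h := (tendsto_exp_sub_one_div.comp hy').mul (tendsto_mul_log hm x)
    rw [one_mul] at h
    refine h.congr fun j => ?_
    rw [one_add_div_pow_eq_exp hx ((hnm j).1.trans_le (hnm j).2)]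
    have h₁ := (hpos j).1
    have h₂ := (hpos j).2
    have h₃ := hlog j
    simp only [Function.comp]
    generalize Real.log (1 + x / (m j : ℝ)) = y at h₃ ⊢
    field_simp
  · have h := ((tendsto_one_add_div_pow hm hnm hlim hx).sub_const 1).div hlim hα
    refine h.congr fun j => ?_
    simp only [Pi.div_apply]
    rw [div_div_eq_mul_div, mul_comm, mul_div_right_comm]

end Asymptotics

/-! ### The limit distributions and their means. -/

section Laws

theorem law_singleton (p : ℕ → ℝ) (k : ℕ) : law p {k} = ENNReal.ofReal (p k) := by
  rw [law, Measure.sum_apply _ (measurableSet_singleton k), tsum_eq_single k]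
  · simp
  · intro i hi
    simp [hi]

theorem hasMean_of_hasSum {p : ℕ → ℝ} {μ : ℝ} (hp : ∀ k, 0 ≤ p k) (h₁ : HasSum p 1)
    (hμ : HasSum (fun k : ℕ => (k : ℝ) * p k) μ) : HasMean p μ := by
  have hint : Integrable (fun k : ℕ => (k : ℝ)) (law p) := by
    refine ⟨by fun_prop, ?_⟩
    rw [HasFiniteIntegral, lintegral_countable']
    simp only [law_singleton]
    have : ∀ k : ℕ, ‖(k : ℝ)‖ₑ * ENNReal.ofReal (p k) = ENNReal.ofReal (k * p k) := fun k => by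
      rw [Real.enorm_of_nonneg (by positivity), ENNReal.ofReal_mul (by positivity)]
    simp only [this]
    exact hμ.summable.tsum_ofReal_lt_top
  refine ⟨⟨hp, h₁⟩, hint, ?_⟩
  rw [integral_countable hint, ← hμ.tsum_eq]
  exact tsum_congr fun k => by
    simp [Measure.real, law_singleton, ENNReal.toReal_ofReal (hp k), mul_comm]

theorem HasMean.integral_eq {p : ℕ → ℝ} {μ : ℝ} (h : HasMean p μ) :
    ∫ k : ℕ, (k : ℝ) ∂(law p) = μ := h.2.2

variable {α : ℝ}

/-- On `[0, α]` the ratio 1 - e^(-t) stays below 1 - e^(-α) < 1, so the power series at that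
endpoint, times a bound for `g`, dominates the terms and sum and integral may be exchanged. -/
theorem hasSum_integral_mul_pow (hα : 0 ≤ α) {g : ℝ → ℝ} (hg : Continuous g) {w : ℕ → ℝ}
    {φ : ℝ → ℝ} (hw : ∀ r : ℝ, 0 ≤ r → r < 1 → HasSum (fun k => w k * r ^ k) (φ r))
    (hw0 : ∀ k, 0 ≤ w k) :
    HasSum (fun k => w k * ∫ t in (0 : ℝ)..α, g t * (1 - Real.exp (-t)) ^ k)
      (∫ t in (0 : ℝ)..α, g t * φ (1 - Real.exp (-t))) := by
  obtain ⟨C, hC⟩ := (isCompact_Icc (a := 0) (b := α)).exists_bound_of_continuousOn hg.continuousOn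
  have hr : ∀ t ∈ Set.Icc 0 α, 0 ≤ 1 - Real.exp (-t) ∧
      1 - Real.exp (-t) ≤ 1 - Real.exp (-α) := by
    intro t ht
    have h₁ : Real.exp (-t) ≤ 1 := Real.exp_le_one_iff.2 (by linarith [ht.1])
    have h₂ : Real.exp (-α) ≤ Real.exp (-t) := Real.exp_le_exp.2 (by linarith [ht.2])
    constructor <;> linarith
  have hr1 : 1 - Real.exp (-α) < 1 := by linarith [Real.exp_pos (-α)]
  have hsum := hw _ (hr α ⟨hα, le_rfl⟩).1 hr1
  have hsub : Set.uIoc 0 α ⊆ Set.Icc 0 α := by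
    rw [Set.uIoc_of_le hα]
    exact Set.Ioc_subset_Icc_self
  have key := intervalIntegral.hasSum_integral_of_dominated_convergence (μ := volume)
    (a := 0) (b := α)
    (F := fun k t => w k * (g t * (1 - Real.exp (-t)) ^ k))
    (f := fun t => g t * φ (1 - Real.exp (-t)))
    (fun k _ => C * (w k * (1 - Real.exp (-α)) ^ k))
    (fun k => by fun_prop)
    (fun k => .of_forall fun t ht => by
      have ht := hsub ht
      obtain ⟨h₁, h₂⟩ := hr t ht
      have hgt := hC t ht
      rw [norm_mul, norm_mul, norm_pow, Real.norm_of_nonneg (hw0 k), Real.norm_of_nonneg h₁]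
      have : (1 - Real.exp (-t)) ^ k ≤ (1 - Real.exp (-α)) ^ k := pow_le_pow_left₀ h₁ h₂ k
      calc w k * (‖g t‖ * (1 - Real.exp (-t)) ^ k)
          ≤ w k * (C * (1 - Real.exp (-α)) ^ k) := by
            refine mul_le_mul_of_nonneg_left ?_ (hw0 k)
            exact mul_le_mul hgt this (by positivity) ((norm_nonneg _).trans hgt)
        _ = _ := by ring)
    (.of_forall fun t _ => (hsum.summable.mul_left C))
    intervalIntegrable_const
    (.of_forall fun t ht => by
      obtain ⟨h₁, h₂⟩ := hr t (hsub ht)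
      have := (hw _ h₁ (h₂.trans_lt hr1)).mul_left (g t)
      simpa only [mul_left_comm] using this)
  simpa only [intervalIntegral.integral_const_mul] using key

theorem hasSum_integral_geometric (hα : 0 ≤ α) {g : ℝ → ℝ} (hg : Continuous g) :
    HasSum (fun k : ℕ => ∫ t in (0 : ℝ)..α, g t * (1 - Real.exp (-t)) ^ k)
      (∫ t in (0 : ℝ)..α, g t * Real.exp t) := by
  have h := hasSum_integral_mul_pow hα hg (w := fun _ => 1) (φ := fun r => (1 - r)⁻¹)
    (fun r h₀ h₁ => by simpa using hasSum_geometric_of_lt_one h₀ h₁) (fun _ => zero_le_one)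
  simpa [Real.exp_neg] using h

theorem hasSum_integral_geometric_deriv (hα : 0 ≤ α) {g : ℝ → ℝ} (hg : Continuous g) :
    HasSum (fun k : ℕ => (k + 1 : ℝ) * ∫ t in (0 : ℝ)..α, g t * (1 - Real.exp (-t)) ^ k)
      (∫ t in (0 : ℝ)..α, g t * Real.exp (2 * t)) := by
  have h := hasSum_integral_mul_pow hα hg (w := fun k => k + 1) (φ := fun r => ((1 - r) ^ 2)⁻¹)
    (fun r h₀ h₁ => by
      have hr : ‖r‖ < 1 := by rwa [Real.norm_of_nonneg h₀]
      -- With parameter 1 the binomial coefficient is k + 1.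
      have := hasSum_choose_mul_geometric_of_norm_lt_one 1 hr
      simpa using this) (fun k => by positivity)
  have e : ∀ t : ℝ, Real.exp (2 * t) = Real.exp t ^ 2 := fun t => by
    rw [← Real.exp_nat_mul]; norm_num
  simpa [Real.exp_neg, e] using h

theorem one_sub_exp_neg_nonneg {t : ℝ} (ht : 0 ≤ t) : 0 ≤ 1 - Real.exp (-t) := by
  linarith [Real.exp_le_one_iff.2 (by linarith : -t ≤ 0)]

/-- The mean of a distribution whose positive part is a mixture of geometric weights. -/
theorem hasMean_of_mixture (hα : 0 ≤ α) {p : ℕ → ℝ} {c : ℝ} {g : ℝ → ℝ} (hg : Continuous g)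
    (hc : 0 ≤ c) (hg0 : ∀ t ∈ Set.Icc 0 α, 0 ≤ g t) (hp0 : 0 ≤ p 0)
    (hp : ∀ k, p (k + 1) = c * ∫ t in (0 : ℝ)..α, g t * (1 - Real.exp (-t)) ^ k)
    (h₁ : p 0 + c * ∫ t in (0 : ℝ)..α, g t * Real.exp t = 1) :
    HasMean p (c * ∫ t in (0 : ℝ)..α, g t * Real.exp (2 * t)) := by
  refine hasMean_of_hasSum ?_ ?_ ?_
  · rintro (_ | k)
    · exact hp0
    · rw [hp]
      exact mul_nonneg hc (intervalIntegral.integral_nonneg hα fun t ht =>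
        mul_nonneg (hg0 t ht) (pow_nonneg (one_sub_exp_neg_nonneg ht.1) k))
  · rw [← hasSum_nat_add_iff' 1]
    simpa [hp, ← h₁] using (hasSum_integral_geometric hα hg).mul_left c
  -- The term at 0 drops out of the mean, and the shifted factor k + 1 turns the geometric series
  -- into its derivative, here e^(2t).
  · rw [← hasSum_nat_add_iff' 1]
    simpa [hp, mul_left_comm c] using (hasSum_integral_geometric_deriv hα hg).mul_left c

theorem hasMean_pU (hα : α ∈ Set.Icc (0 : ℝ) 1) :
    HasMean (pU α) (1 / 4 * (Real.exp (2 * α) - 1) + α / 2) := by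
  have h₁ : ∫ t in (0 : ℝ)..α, (1 - α + t) * Real.exp t = α := by
    rw [intervalIntegral.integral_eq_sub_of_hasDerivAt (f := fun t => (t - α) * Real.exp t)
      (fun t _ => ?_) (Continuous.intervalIntegrable (by fun_prop) _ _)]
    · simp
    · refine HasDerivAt.congr_deriv (((hasDerivAt_id t).sub_const α).mul (Real.hasDerivAt_exp t)) ?_
      simp only [id]
      ring
  have h₂ : ∫ t in (0 : ℝ)..α, (1 - α + t) * Real.exp (2 * t) =
      1 / 4 * (Real.exp (2 * α) - 1) + α / 2 := by
    rw [intervalIntegral.integral_eq_sub_of_hasDerivAt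
      (f := fun t => ((1 - α + t) / 2 - 1 / 4) * Real.exp (2 * t))
      (fun t _ => ?_) (Continuous.intervalIntegrable (by fun_prop) _ _)]
    · simp only [mul_zero, Real.exp_zero]
      ring
    · refine HasDerivAt.congr_deriv (((((hasDerivAt_id t).const_add (1 - α)).div_const 2).sub_const (1 / 4)).mul
        ((hasDerivAt_id t).const_mul 2).exp) ?_
      simp only [id]
      ring
  have h := hasMean_of_mixture (p := pU α) (c := 1) hα.1
    (g := fun t => 1 - α + t) (by fun_prop) zero_le_one
    (fun t ht => by linarith [ht.1, hα.2]) (by simpa [pU] using hα.2) (fun k => by simp [pU])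
    (by simp [pU, h₁])
  rwa [one_mul, h₂] at h

theorem hasMean_zero {p : ℕ → ℝ} (h₀ : p 0 = 1) (h : ∀ k, p (k + 1) = 0) : HasMean p 0 := by
  have h' : ∀ k, k ≠ 0 → p k = 0 := fun k hk => by
    obtain ⟨k, rfl⟩ := Nat.exists_eq_succ_of_ne_zero hk
    exact h k
  refine hasMean_of_hasSum (fun k => ?_) ?_ ?_
  · rcases eq_or_ne k 0 with rfl | hk
    · simp [h₀]
    · simp [h' k hk]
  · exact h₀ ▸ hasSum_single 0 h'
  · have : (fun k : ℕ => (k : ℝ) * p k) = fun _ => 0 := by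
      funext k
      rcases eq_or_ne k 0 with rfl | hk
      · simp
      · simp [h' k hk]
    rw [this]
    exact hasSum_zero

theorem hasMean_pL (hα : α ∈ Set.Icc (0 : ℝ) 1) :
    HasMean (pL α)
      (if α = 0 then 0 else 1 / (8 * α) * (Real.exp (2 * α) - 1) + α / 4 - 1 / 4) := by
  split_ifs with h0
  -- At α = 0 the convention `0⁻¹ = 0` and the empty integration range kill all positive masses.
  · exact hasMean_zero (by simp [pL, h0]) (by simp [pL, h0])
  have h₁ : ∫ t in (0 : ℝ)..α, (α - t - (α - t) ^ 2 / 2) * Real.exp t = α ^ 2 / 2 := by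
    rw [intervalIntegral.integral_eq_sub_of_hasDerivAt
      (f := fun t => (-((α - t) ^ 2 / 2)) * Real.exp t)
      (fun t _ => ?_) (Continuous.intervalIntegrable (by fun_prop) _ _)]
    · simp
    · refine HasDerivAt.congr_deriv (((((hasDerivAt_id t).const_sub α).pow 2).div_const 2).neg.mul
        (Real.hasDerivAt_exp t)) ?_
      simp only [id, Pi.neg_apply, Pi.pow_apply]
      push_cast
      ring
  have h₂ : ∫ t in (0 : ℝ)..α, (α - t - (α - t) ^ 2 / 2) * Real.exp (2 * t) =
      1 / 8 * (Real.exp (2 * α) - 1) + α ^ 2 / 4 - α / 4 := by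
    rw [intervalIntegral.integral_eq_sub_of_hasDerivAt
      (f := fun t => (-((α - t) ^ 2 / 4) + (α - t) / 4 + 1 / 8) * Real.exp (2 * t))
      (fun t _ => ?_) (Continuous.intervalIntegrable (by fun_prop) _ _)]
    · simp only [mul_zero, Real.exp_zero]
      ring
    · refine HasDerivAt.congr_deriv (((((((hasDerivAt_id t).const_sub α).pow 2).div_const 4).neg.add
        (((hasDerivAt_id t).const_sub α).div_const 4)).add_const (1 / 8)).mul
        ((hasDerivAt_id t).const_mul 2).exp) ?_
      simp only [id, Pi.neg_apply, Pi.add_apply, Pi.pow_apply]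
      push_cast
      ring
  have h := hasMean_of_mixture (p := pL α) (c := α⁻¹) hα.1
    (g := fun t => α - t - (α - t) ^ 2 / 2) (by fun_prop) (inv_nonneg.2 hα.1)
    (fun t ht => by nlinarith [ht.1, ht.2, hα.2])
    (by simp only [pL]; linarith [hα.2]) (fun k => rfl)
    (by rw [h₁]; simp only [pL]; field_simp; ring)
  rw [h₂] at h
  convert h using 1
  field_simp

theorem hasMean_pE (hα : α ∈ Set.Icc (0 : ℝ) 1) :
    HasMean (pE α) (if α = 0 then 0 else 1 / α * (Real.exp α - 1 - α)) := by
  split_ifs with h0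
  · exact hasMean_zero (by simp [pE, h0]) (by simp [pE, h0])
  have h₁ : ∫ t in (0 : ℝ)..α, (α - t) * Real.exp (-t) * Real.exp t = α ^ 2 / 2 := by
    have e : ∀ t : ℝ, (α - t) * Real.exp (-t) * Real.exp t = α - t := fun t => by
      rw [mul_assoc, ← Real.exp_add]
      simp
    simp only [e]
    rw [intervalIntegral.integral_eq_sub_of_hasDerivAt
      (f := fun t => -((α - t) ^ 2 / 2))
      (fun t _ => ?_) (Continuous.intervalIntegrable (by fun_prop) _ _)]
    · simp
    · refine HasDerivAt.congr_deriv (((((hasDerivAt_id t).const_sub α).pow 2).div_const 2).neg) ?_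
      simp only [id]
      push_cast
      ring
  have h₂ : ∫ t in (0 : ℝ)..α, (α - t) * Real.exp (-t) * Real.exp (2 * t) =
      Real.exp α - 1 - α := by
    have e : ∀ t : ℝ, (α - t) * Real.exp (-t) * Real.exp (2 * t) = (α - t) * Real.exp t :=
      fun t => by
        rw [mul_assoc, ← Real.exp_add]
        ring_nf
    simp only [e]
    rw [intervalIntegral.integral_eq_sub_of_hasDerivAt
      (f := fun t => (α - t + 1) * Real.exp t)
      (fun t _ => ?_) (Continuous.intervalIntegrable (by fun_prop) _ _)]
    · simp only [Real.exp_zero]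
      ring
    · refine HasDerivAt.congr_deriv ((((hasDerivAt_id t).const_sub α).add_const 1).mul (Real.hasDerivAt_exp t)) ?_
      simp only [id]
      ring
  have h := hasMean_of_mixture (p := pE α) (c := α⁻¹) hα.1
    (g := fun t => (α - t) * Real.exp (-t)) (by fun_prop) (inv_nonneg.2 hα.1)
    (fun t ht => mul_nonneg (by linarith [ht.2]) (Real.exp_pos _).le)
    (by simp only [pE]; linarith [hα.2]) (fun k => rfl)
    (by rw [h₁]; simp only [pE]; field_simp; ring)
  rwa [h₂, ← one_div] at h

end Laws

end CoalescedHashing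

/-! ### Assembly of the exact formulas, their limits and the means of the laws. -/

theorem corollary1 (α : ℝ) (hα : α ∈ Set.Icc (0 : ℝ) 1) (m n : ℕ → ℕ)
    (hm : Filter.Tendsto m Filter.atTop Filter.atTop)
    (hn : Filter.Tendsto n Filter.atTop Filter.atTop)
    (hnm : ∀ j, 0 < n j ∧ n j ≤ m j)
    (hlim : Filter.Tendsto (fun j => (n j : ℝ) / (m j : ℝ)) Filter.atTop (nhds α)) :
    ((∀ Ξ : CoalescedHashing.Policy,
        Filter.Tendsto (fun j => CoalescedHashing.meanUnsuccessful Ξ (m j) (n j)) Filter.atTop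
          (nhds (∫ k : ℕ, (k : ℝ) ∂(CoalescedHashing.law (CoalescedHashing.pU α))))) ∧
      CoalescedHashing.HasMean (CoalescedHashing.pU α)
        (1 / 4 * (Real.exp (2 * α) - 1) + α / 2)) ∧
    (Filter.Tendsto (fun j => CoalescedHashing.meanDisplacement .late (m j) (n j)) Filter.atTop
        (nhds (∫ k : ℕ, (k : ℝ) ∂(CoalescedHashing.law (CoalescedHashing.pL α)))) ∧
      CoalescedHashing.HasMean (CoalescedHashing.pL α)
        (if α = 0 then 0 else 1 / (8 * α) * (Real.exp (2 * α) - 1) + α / 4 - 1 / 4)) ∧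
    (Filter.Tendsto (fun j => CoalescedHashing.meanDisplacement .early (m j) (n j)) Filter.atTop
        (nhds (∫ k : ℕ, (k : ℝ) ∂(CoalescedHashing.law (CoalescedHashing.pE α)))) ∧
      CoalescedHashing.HasMean (CoalescedHashing.pE α)
        (if α = 0 then 0 else 1 / α * (Real.exp α - 1 - α))) := by
  have hU := CoalescedHashing.hasMean_pU hα
  have hL := CoalescedHashing.hasMean_pL hα
  have hE := CoalescedHashing.hasMean_pE hα
  rw [hU.integral_eq, hL.integral_eq, hE.integral_eq]
  refine ⟨⟨fun Ξ => ?_, hU⟩, ⟨?_, hL⟩, ?_, hE⟩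
  · have h := (((CoalescedHashing.tendsto_one_add_div_pow hm hnm hlim
      two_pos).sub_const 1).const_mul (1 / 4)).add (hlim.div_const 2)
    exact h.congr fun j =>
      (CoalescedHashing.meanUnsuccessful_eq Ξ (hnm j).1 (hnm j).2).symm
  · have hinv : Filter.Tendsto (fun j => 1 / (m j : ℝ)) Filter.atTop (nhds 0) :=
      tendsto_one_div_atTop_nhds_zero_nat.comp hm
    have h := (((((CoalescedHashing.tendsto_div_mul_one_add_div_pow_sub_one hm hnm hlim
      two_pos).const_mul (1 / 8)).add (hlim.div_const 4)).sub (hinv.div_const 4)).sub_const (1 / 4))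
    convert h.congr fun j =>
      (CoalescedHashing.meanDisplacement_late_eq (hnm j).1 (hnm j).2).symm using 2
    -- For α = 0 the first term tends to 2/8, which cancels the constant -1/4.
    split_ifs with h0
    · rw [h0]
      norm_num
    · field_simp
      ring
  · have h := (CoalescedHashing.tendsto_div_mul_one_add_div_pow_sub_one hm hnm hlim
      one_pos).sub_const 1
    convert h.congr fun j =>
      (CoalescedHashing.meanDisplacement_early_eq (hnm j).1 (hnm j).2).symm using 2
    split_ifs with h0
    · norm_num
    · rw [one_mul]
      field_simp
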